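/- Let $A$ be a commutative Noetherian ring containing a field of characteristic zero, and let $R=A[X_1,\ldots,X_d]$ be $\mathbb{Z}^d$-graded by $\deg z=0$ for $z\in A$ and $\deg X_k=e_k$. Let $I\subseteq R$ be a $\mathfrak{C}$-monomial ideal, i.e. $I=(a_1U_1,\ldots,a_tU_t)$ with $a_j\in A$ (possibly nonunits) and $U_j$ monomials in $X_1,\ldots,X_d$. For $i\ge 0$ let $$M=H^i_I(R)=\bigoplus_{\underline u\in\mathbb{Z}^d}M_{\underline u}$$ be the $i$-th local cohomology module, computed as the $i$-th cohomology of the Čech complex of $R$ on $a_1U_1,\ldots,a_tU_t$, with the $\mathbb{Z}^d$-grading induced from this complex: $M_{\underline u}$ is the $A$-module of classes of cocycles of multidegree $\underline u$. For a (possibly empty) subset $U\subseteq\{1,\ldots,d\}$ let $\underline a^U\in\mathbb{Z}^d$ be the vector with $a^U_k=0$ if $k\in U$ and $a^U_k=-1$ if $k\notin U$, and let $$\mathcal B(\underline a^U)=\{\underline u\in\mathbb{Z}^d \mid u_k\ge 0 \text{ if } k\in U \text{ and } u_k\le -1 \text{ if } k\notin U\}.$$ Then the following are equivalent: (a) $M_{\underline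 u}\neq 0$ for all $\underline u\in\mathcal B(\underline a^U)$; (b) $M_{\underline w}\neq 0$ for some $\underline w\in\mathcal B(\underline a^U)$. Moreover, $M_{\underline u}\cong M_{\underline a^U}$ as $A$-modules for all $\underline u\in\mathcal B(\underline a^U)$. -/

import Mathlib

open MvPolynomial

/-! ### The Čech complex of a finite sequence and its cohomology -/

section Cech

variable {R : Type*} [CommRing R]

/-- The canonical `R`-algebra map `R_x → R_y` between localizations, for `x ∣ y`. -/
noncomputable def awayRes {x y : R} (h : x ∣ y) :
    Localization.Away x →ₐ[R] Localization.Away y :=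
  IsLocalization.liftAlgHom (M := Submonoid.powers x)
    (f := Algebra.ofId R (Localization.Away y)) (by
      rintro ⟨_, n, rfl⟩
      have hy : IsUnit (algebraMap R (Localization.Away y) y) :=
        IsLocalization.Away.algebraMap_isUnit y
      have hx : IsUnit (algebraMap R (Localization.Away y) x) :=
        isUnit_of_dvd_unit (map_dvd _ h) hy
      simpa [Algebra.ofId_apply] using hx.pow n)

/-- The Čech cochains of degree `p` of a sequence `g_1, …, g_t` in `R`: the product, over all
`S ⊆ {1, …, t}` with `p` elements, of the localizations of `R` at `∏_{j ∈ S} g_j`. -/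
abbrev CechCochain {t : ℕ} (g : Fin t → R) (p : ℕ) : Type _ :=
  ∀ S : {S : Finset (Fin t) // S.card = p}, Localization.Away (∏ j ∈ S.1, g j)

/-- The Čech differential: the component of `dx` at `S = {j_0 < ⋯ < j_p}` is the alternating
sum `∑_k (-1)^k x_{S \ {j_k}}`, computed in the localization at `∏_{j ∈ S} g_j`. -/
noncomputable def cechD {t : ℕ} (g : Fin t → R) (p : ℕ) :
    CechCochain g p →ₗ[R] CechCochain g (p + 1) :=
  LinearMap.pi fun S => ∑ j : {j // j ∈ S.1},
    ((-1 : R) ^ (S.1.filter (· < j.1)).card) •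
      ((awayRes (Finset.prod_dvd_prod_of_subset _ _ g (S.1.erase_subset j.1))).toLinearMap ∘ₗ
        LinearMap.proj (⟨S.1.erase j.1, by
          rw [Finset.card_erase_of_mem j.2, S.2]; rfl⟩ :
            {S : Finset (Fin t) // S.card = p}))

theorem awayRes_comp {x y z : R} (h : x ∣ y) (h' : y ∣ z) :
    (awayRes h').comp (awayRes h) = awayRes (h.trans h') :=
  (IsLocalization.algHom_subsingleton (Submonoid.powers x)).elim _ _

theorem awayRes_awayRes {x y z : R} (h : x ∣ y) (h' : y ∣ z) (a : Localization.Away x) :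
    awayRes h' (awayRes h a) = awayRes (h.trans h') a := by
  rw [← awayRes_comp h h']
  rfl

theorem cechD_apply {t : ℕ} (g : Fin t → R) (p : ℕ) (x : CechCochain g p)
    (S : {S : Finset (Fin t) // S.card = p + 1}) :
    cechD g p x S = ∑ j : {j // j ∈ S.1}, ((-1 : R) ^ (S.1.filter (· < j.1)).card) •
      awayRes (Finset.prod_dvd_prod_of_subset _ _ g (S.1.erase_subset j.1))
        (x ⟨S.1.erase j.1, by rw [Finset.card_erase_of_mem j.2, S.2]; rfl⟩) := by
  simp only [cechD, LinearMap.pi_apply, LinearMap.sum_apply]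
  rfl

/-- The Čech differential squares to zero. -/
theorem cechD_comp_cechD {t : ℕ} (g : Fin t → R) (p : ℕ) :
    cechD g (p + 1) ∘ₗ cechD g p = 0 := by
  refine LinearMap.ext fun x => funext fun S => ?_
  let y : Finset (Fin t) → Localization.Away (∏ j ∈ S.1, g j) := fun T =>
    if h : T ⊆ S.1 ∧ T.card = p then
      awayRes (Finset.prod_dvd_prod_of_subset _ _ g h.1) (x ⟨T, h.2⟩) else 0
  have key : (cechD g (p + 1) (cechD g p x)) S =
      ∑ j ∈ S.1, ∑ k ∈ S.1.erase j, ((-1 : R) ^ (S.1.filter (· < j)).card *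
        (-1 : R) ^ ((S.1.erase j).filter (· < k)).card) • y ((S.1.erase j).erase k) := by
    rw [← Finset.sum_attach S.1]
    rw [cechD_apply]
    refine Finset.sum_congr rfl fun j _ => ?_
    rw [cechD_apply, map_sum, ← Finset.sum_attach (S.1.erase j.1), Finset.smul_sum]
    refine Finset.sum_congr rfl fun k _ => ?_
    have hs : ((S.1.erase j.1).erase k.1) ⊆ S.1 ∧ ((S.1.erase j.1).erase k.1).card = p :=
      ⟨(Finset.erase_subset _ _).trans (Finset.erase_subset _ _), by
        rw [Finset.card_erase_of_mem k.2, Finset.card_erase_of_mem j.2, S.2]; rfl⟩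
    simp only [y, dif_pos hs]
    rw [mul_smul, map_smul, awayRes_awayRes]
  rw [LinearMap.comp_apply, key, Finset.sum_sigma']
  refine Finset.sum_involution (fun q _ => ⟨q.2, q.1⟩) ?_ ?_ ?_ ?_
  · rintro ⟨j, k⟩ hq
    simp only [Finset.mem_sigma, Finset.mem_erase] at hq
    obtain ⟨hj, hkj, hk⟩ := hq
    have aux : ∀ a b : Fin t, b ∈ S.1 → b < a →
        (S.1.filter (· < a)).card = ((S.1.erase b).filter (· < a)).card + 1 ∧
          ((S.1.erase a).filter (· < b)).card = (S.1.filter (· < b)).card := by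
      intro a b hb hba
      constructor
      · rw [Finset.filter_erase, Finset.card_erase_add_one]
        exact Finset.mem_filter.mpr ⟨hb, hba⟩
      · rw [Finset.filter_erase, Finset.erase_eq_of_notMem]
        simp [hba.le]
    rw [Finset.erase_right_comm (a := k), ← add_smul]
    rcases lt_or_gt_of_ne hkj with h | h
    · rw [(aux j k hk h).1, (aux j k hk h).2, pow_succ]
      convert zero_smul R _
      ring
    · rw [(aux k j hj h).1, (aux k j hj h).2, pow_succ]
      convert zero_smul R _
      ring
  · rintro ⟨j, k⟩ hq _ h
    simp only [Finset.mem_sigma, Finset.mem_erase] at hq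
    simp only [Sigma.mk.injEq] at h
    exact hq.2.1 h.1
  · rintro ⟨j, k⟩ hq
    simp only [Finset.mem_sigma, Finset.mem_erase] at hq ⊢
    exact ⟨hq.2.2, hq.2.1.symm, hq.1⟩
  · rintro ⟨j, k⟩ _
    rfl

/-- The cocycles of degree `p`. -/
noncomputable abbrev cechCocycles {t : ℕ} (g : Fin t → R) (p : ℕ) :
    Submodule R (CechCochain g p) :=
  LinearMap.ker (cechD g p)

/-- The coboundaries of degree `p`. -/
noncomputable def cechCoboundaries {t : ℕ} (g : Fin t → R) :
    (p : ℕ) → Submodule R (CechCochain g p)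
  | 0 => ⊥
  | p + 1 => LinearMap.range (cechD g p)

/-- The `p`-th cohomology module of the Čech complex of `g_1, …, g_t`, that is, cocycles modulo
coboundaries. -/
abbrev CechCohomology {t : ℕ} (g : Fin t → R) (p : ℕ) : Type _ :=
  cechCocycles g p ⧸ (cechCoboundaries g p).submoduleOf (cechCocycles g p)

end Cech

/-! ### The multigrading -/

section Multigrading

variable {A : Type*} [CommRing A] {d : ℕ}

/-- The weights `deg X_i = e_i ∈ ℤ^d`. -/
def stdWeight (d : ℕ) : Fin d → (Fin d → ℤ) := fun i => Pi.single i 1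

/-- The component of degree `u ∈ ℤ^d` of the localization at `x` of `A[X_1, …, X_d]`, where `x` is
multihomogeneous of degree `δ`: the elements `r / x ^ n` with `r` multihomogeneous of degree
`u + n δ`. -/
noncomputable def awayPart {x : MvPolynomial (Fin d) A} {δ : Fin d → ℤ}
    (hx : IsWeightedHomogeneous (stdWeight d) x δ) (u : Fin d → ℤ) :
    Submodule A (Localization.Away x) where
  carrier := {y | ∃ (n : ℕ) (r : MvPolynomial (Fin d) A),
    IsWeightedHomogeneous (stdWeight d) r (u + n • δ) ∧
      y = Localization.mk r (⟨x ^ n, n, rfl⟩ : Submonoid.powers x)}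
  zero_mem' := ⟨0, 0, isWeightedHomogeneous_zero A _ _, (Localization.mk_zero _).symm⟩
  add_mem' := by
    rintro _ _ ⟨n, r, hr, rfl⟩ ⟨k, s, hs, rfl⟩
    refine ⟨n + k, x ^ n * s + x ^ k * r, ?_, ?_⟩
    · refine IsWeightedHomogeneous.add ?_ ?_
      · have h := (hx.pow n).mul hs
        rwa [show n • δ + (u + k • δ) = u + (n + k) • δ by rw [add_smul]; abel] at h
      · have h := (hx.pow k).mul hr
        rwa [show k • δ + (u + n • δ) = u + (n + k) • δ by rw [add_smul]; abel] at h
    · rw [Localization.add_mk]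
      congr 1
      exact Subtype.ext (pow_add x n k).symm
  smul_mem' := by
    rintro c _ ⟨n, r, hr, rfl⟩
    exact ⟨n, c • r, (weightedHomogeneousSubmodule A (stdWeight d) _).smul_mem c hr,
      Localization.smul_mk c r _⟩

end Multigrading

/-! ### `ℭ`-monomial ideals, their local cohomology, and its multigrading -/

section CMonomial

variable {A : Type*} [CommRing A] {d : ℕ}

/-- A `ℭ`-monomial ideal of `A[X_1, …, X_d]`: an ideal which can be generated by elements of the
form `a U` with `a ∈ A` and `U` a monomial in `X_1, …, X_d`. -/
def IsCMonomialIdeal (I : Ideal (MvPolynomial (Fin d) A)) : Prop :=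
  ∃ E : Set (A × (Fin d →₀ ℕ)), I = Ideal.span ((fun e => monomial e.2 e.1) '' E)

/-- A finite system of generators `a_1 U_1, …, a_t U_t` of an ideal `I` with `a_j ∈ A` and `U_j` a
monomial, recorded by its exponent. -/
structure CMonomialGenerators (I : Ideal (MvPolynomial (Fin d) A)) where
  /-- the number of generators -/
  t : ℕ
  /-- the coefficients `a_j` -/
  coeff : Fin t → A
  /-- the exponents of the monomials `U_j` -/
  expo : Fin t → (Fin d →₀ ℕ)
  span_eq : I = Ideal.span (Set.range fun j => monomial (expo j) (coeff j))

/-- Over a Noetherian ring the `ℭ`-monomial ideals are exactly the ideals which have a finite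
system of generators as above. -/
theorem isCMonomialIdeal_iff [IsNoetherianRing A] (I : Ideal (MvPolynomial (Fin d) A)) :
    IsCMonomialIdeal I ↔ Nonempty (CMonomialGenerators I) := by
  constructor
  · rintro ⟨E, hE⟩
    obtain ⟨s, hs, hs'⟩ := Submodule.fg_span_iff_fg_span_finset_subset _ |>.mp
      (show (Ideal.span ((fun e : A × (Fin d →₀ ℕ) => monomial e.2 e.1) '' E)).FG from
        IsNoetherian.noetherian _)
    have hc : ∀ x : s, ∃ e : A × (Fin d →₀ ℕ), monomial e.2 e.1 = x.1 := fun x =>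
      let ⟨e, _, he⟩ := hs x.2
      ⟨e, he⟩
    choose c hc using hc
    refine ⟨⟨s.card, fun j => (c (s.equivFin.symm j)).1, fun j => (c (s.equivFin.symm j)).2, ?_⟩⟩
    rw [hE, Ideal.span, hs', Ideal.span]
    congr 1
    ext x
    constructor
    · intro hx
      exact ⟨s.equivFin ⟨x, hx⟩, by simp [hc]⟩
    · rintro ⟨j, rfl⟩
      simp [hc]
  · rintro ⟨P⟩
    refine ⟨Set.range fun j => (P.coeff j, P.expo j), ?_⟩
    rw [← Set.range_comp]
    exact P.span_eq

namespace CMonomialGenerators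

variable {I : Ideal (MvPolynomial (Fin d) A)} (P : CMonomialGenerators I)

/-- The generators `a_j U_j`. -/
noncomputable def gen (j : Fin P.t) : MvPolynomial (Fin d) A :=
  monomial (P.expo j) (P.coeff j)

/-- The multidegree of `U_j`. -/
def deg (j : Fin P.t) : Fin d → ℤ := fun k => (P.expo j k : ℤ)

theorem gen_homogeneous (j : Fin P.t) :
    IsWeightedHomogeneous (stdWeight d) (P.gen j) (P.deg j) := by
  refine isWeightedHomogeneous_monomial _ _ _ ?_
  ext k
  simp [Finsupp.weight_apply, Finsupp.sum_fintype, stdWeight, deg, Pi.single_apply]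

theorem prod_gen_homogeneous (S : Finset (Fin P.t)) :
    IsWeightedHomogeneous (stdWeight d) (∏ j ∈ S, P.gen j) (∑ j ∈ S, P.deg j) :=
  IsWeightedHomogeneous.prod S _ _ fun j _ => P.gen_homogeneous j

/-- The local cohomology module `H^i_I(R)`, `R = A[X_1, …, X_d]`, computed by the Čech complex of
the given generators of `I`. -/
abbrev LocalCohomology (i : ℕ) : Type _ := CechCohomology P.gen i

/-- The cochains of multidegree `u`: those all of whose components have multidegree `u`. -/
noncomputable def cochainPart (i : ℕ) (u : Fin d → ℤ) : Submodule A (CechCochain P.gen i) :=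
  Submodule.pi Set.univ fun S => awayPart (P.prod_gen_homogeneous S.1) u

/-- The component of multidegree `u ∈ ℤ^d` of `H^i_I(R)`, an `A`-module: the classes of the
cocycles of multidegree `u`. -/
noncomputable def component (i : ℕ) (u : Fin d → ℤ) : Submodule A (P.LocalCohomology i) :=
  ((P.cochainPart i u).comap ((cechCocycles P.gen i).subtype.restrictScalars A)).map
    (((cechCoboundaries P.gen i).submoduleOf (cechCocycles P.gen i)).mkQ.restrictScalars A)

end CMonomialGenerators

end CMonomial

/-! ### Blocks -/

/-- The vector `a^U ∈ {0, -1}^d`, with entry `0` at `k ∈ U` and `-1` at `k ∉ U`. -/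
def blockVector {d : ℕ} (U : Finset (Fin d)) : Fin d → ℤ := fun k => if k ∈ U then 0 else -1

/-- The block `B(a^U)`. -/
def block {d : ℕ} (U : Finset (Fin d)) : Set (Fin d → ℤ) :=
  {u | ∀ k, (k ∈ U → 0 ≤ u k) ∧ (k ∉ U → u k ≤ -1)}

/-! Multiplication by a monomial `X^v` is a chain map on the Čech complex that shifts multidegrees
by `v`. It is injective on every localization, since monomials with coefficient 1 are
nonzerodivisors. If `u` and `u + v` lie in one block, it also maps the part of degree `u` onto that
of degree `u + v` (`exists_monomial_smul_eq`): for each `k`, either a power of `x` in the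
denominator supplies all the `X_k` needed, or `x` has degree 0 in `X_k` and the sign condition gives
divisibility.

So the two strands of the complex are isomorphic. Since a component consists of classes in the full
cohomology, one must also know that a homogeneous coboundary bounds a homogeneous cochain. This
follows from degree projections that commute with the differential (`cochainProj_cechD`). Two
degrees of one block are compared through their supremum. -/

/-! ### Multihomogeneous polynomials -/

section Monomials

variable {A : Type*} [CommRing A] {d : ℕ}

/-- The multidegree of a monomial, as a vector of integers. -/
def intDegree (v : Fin d →₀ ℕ) : Fin d → ℤ := fun k => (v k : ℤ)

theorem weight_stdWeight (v : Fin d →₀ ℕ) : Finsupp.weight (stdWeight d) v = intDegree v := by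
  ext k
  simp [Finsupp.weight_apply, Finsupp.sum_fintype, stdWeight, intDegree, Pi.single_apply]

theorem monomial_homogeneous (v : Fin d →₀ ℕ) (c : A) :
    IsWeightedHomogeneous (stdWeight d) (monomial v c) (intDegree v) :=
  isWeightedHomogeneous_monomial _ _ _ (weight_stdWeight v)

theorem intDegree_injective : Function.Injective (intDegree (d := d)) := fun v w h =>
  Finsupp.ext fun k => by simpa [intDegree] using congrFun h k

/-- A multihomogeneous polynomial is zero or a monomial. -/
theorem MvPolynomial.IsWeightedHomogeneous.eq_zero_or_monomial {r : MvPolynomial (Fin d) A}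
    {u : Fin d → ℤ} (hr : IsWeightedHomogeneous (stdWeight d) r u) :
    r = 0 ∨ ∃ (w : Fin d →₀ ℕ) (c : A), r = monomial w c ∧ intDegree w = u := by
  by_cases h : r = 0
  · exact Or.inl h
  obtain ⟨w, hw⟩ := MvPolynomial.ne_zero_iff.mp h
  have hwu : intDegree w = u := (weight_stdWeight w).symm.trans (hr hw)
  refine Or.inr ⟨w, coeff w r, ?_, hwu⟩
  ext e
  rw [coeff_monomial]
  split_ifs with he
  · rw [he]
  · by_contra hne
    exact he (intDegree_injective (hwu.trans (hr hne).symm ▸ (weight_stdWeight e).symm ▸ rfl))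

theorem isLeftRegular_monomial_one (v : Fin d →₀ ℕ) :
    IsLeftRegular (monomial v (1 : A)) := by
  intro p q h
  ext e
  have := congrArg (coeff (v + e)) h
  simpa [coeff_monomial_mul] using this

end Monomials

/-! ### Degree projections on the localizations -/

section Coaction

variable {A : Type*} [CommRing A] {d : ℕ}

/-- The map `A[X_1, …, X_d] → L[ℤ^d]` which sends `X_k` to `X_k t^{e_k}`. -/
noncomputable def polyCoaction (L : Type*) [CommRing L] [Algebra A L]
    [Algebra (MvPolynomial (Fin d) A) L] :
    MvPolynomial (Fin d) A →ₐ[A] AddMonoidAlgebra L (Fin d → ℤ) :=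
  aeval fun k => .single (stdWeight d k) (algebraMap (MvPolynomial (Fin d) A) L (X k))

variable {L : Type*} [CommRing L] [Algebra A L] [Algebra (MvPolynomial (Fin d) A) L]
  [IsScalarTower A (MvPolynomial (Fin d) A) L]

theorem polyCoaction_monomial (v : Fin d →₀ ℕ) (c : A) :
    polyCoaction L (monomial v c) =
      .single (intDegree v) (algebraMap (MvPolynomial (Fin d) A) L (monomial v c)) := by
  have h1 : polyCoaction L (monomial v (1 : A)) =
      .single (intDegree v) (algebraMap (MvPolynomial (Fin d) A) L (monomial v 1)) := by
    induction v using Finsupp.induction_linear with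
    | zero =>
      have h0 : intDegree (0 : Fin d →₀ ℕ) = 0 := by ext k; simp [intDegree]
      have h1 : monomial (0 : Fin d →₀ ℕ) (1 : A) = 1 := rfl
      rw [h0, h1, map_one, map_one, AddMonoidAlgebra.one_def]
    | add v w hv hw =>
      have h0 : intDegree (v + w) = intDegree v + intDegree w := by
        ext k; simp [intDegree]
      have h1 : monomial (v + w) (1 : A) = monomial v 1 * monomial w 1 := by
        rw [monomial_mul, one_mul]
      rw [h1, map_mul, hv, hw, AddMonoidAlgebra.single_mul_single, h0, map_mul]
    | single k n =>
      have h0 : intDegree (Finsupp.single k n) = n • stdWeight d k := by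
        ext l
        simp [intDegree, stdWeight, Finsupp.single_apply, Pi.single_apply, eq_comm]
      have h1 : monomial (Finsupp.single k n) (1 : A) = X k ^ n := by
        rw [X_pow_eq_monomial]
      rw [h0, h1, map_pow, map_pow, polyCoaction, aeval_X, AddMonoidAlgebra.single_pow]
  have hc : monomial v c = c • monomial v (1 : A) := by
    rw [smul_monomial, smul_eq_mul, mul_one]
  rw [hc, map_smul, h1, AddMonoidAlgebra.smul_single]
  simp [Algebra.smul_def, IsScalarTower.algebraMap_apply A (MvPolynomial (Fin d) A) L]

theorem polyCoaction_of_homogeneous {r : MvPolynomial (Fin d) A} {u : Fin d → ℤ}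
    (hr : IsWeightedHomogeneous (stdWeight d) r u) :
    polyCoaction L r = .single u (algebraMap (MvPolynomial (Fin d) A) L r) := by
  obtain rfl | ⟨w, c, rfl, rfl⟩ := hr.eq_zero_or_monomial
  · simp
  · exact polyCoaction_monomial w c

variable {x y : MvPolynomial (Fin d) A} {δ ε : Fin d → ℤ}

/-- The image of `x` is `x t^δ`, with inverse `x⁻¹ t^(-δ)`; hence the coaction extends to `R_x`. -/
theorem isUnit_polyCoaction_away (hx : IsWeightedHomogeneous (stdWeight d) x δ)
    (s : Submonoid.powers x) : IsUnit (polyCoaction (Localization.Away x) s.1) := by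
  obtain ⟨_, n, rfl⟩ := s
  obtain ⟨b, hb⟩ := (IsLocalization.Away.algebraMap_isUnit (S := Localization.Away x) x).exists_right_inv
  refine (map_pow (polyCoaction (Localization.Away x)) x n) ▸ IsUnit.pow n ?_
  refine IsUnit.of_mul_eq_one (.single (-δ) b) ?_
  rw [polyCoaction_of_homogeneous hx, AddMonoidAlgebra.single_mul_single, hb, add_neg_cancel,
    AddMonoidAlgebra.one_def]

/-- The coaction `R_x → R_x[ℤ^d]` which encodes the `ℤ^d`-grading of `R_x`. -/
noncomputable def awayCoaction (hx : IsWeightedHomogeneous (stdWeight d) x δ) :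
    Localization.Away x →ₐ[A] AddMonoidAlgebra (Localization.Away x) (Fin d → ℤ) :=
  IsLocalization.liftAlgHom (M := Submonoid.powers x)
    (f := polyCoaction (Localization.Away x)) (isUnit_polyCoaction_away hx)

theorem awayCoaction_algebraMap (hx : IsWeightedHomogeneous (stdWeight d) x δ)
    (r : MvPolynomial (Fin d) A) :
    awayCoaction hx (algebraMap _ _ r) = polyCoaction (Localization.Away x) r :=
  IsLocalization.lift_eq _ _

theorem awayCoaction_of_mem (hx : IsWeightedHomogeneous (stdWeight d) x δ) {u : Fin d → ℤ}
    {z : Localization.Away x} (hz : z ∈ awayPart hx u) : awayCoaction hx z = .single u z := by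
  obtain ⟨n, r, hr, rfl⟩ := hz
  have hs : Localization.mk r (⟨x ^ n, n, rfl⟩ : Submonoid.powers x) *
      algebraMap _ (Localization.Away x) (x ^ n) = algebraMap _ _ r := by
    rw [Localization.mk_eq_mk']
    exact IsLocalization.mk'_spec (Localization.Away x) r
      (⟨x ^ n, n, rfl⟩ : Submonoid.powers x)
  -- It suffices to compare both sides after multiplying by the unit image of `x ^ n`, which clears
  -- the denominator.
  refine (isUnit_polyCoaction_away hx
    (⟨x ^ n, n, rfl⟩ : Submonoid.powers x)).mul_left_injective ?_
  simp only
  rw [← awayCoaction_algebraMap hx, ← map_mul, hs, awayCoaction_algebraMap,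
    awayCoaction_algebraMap, polyCoaction_of_homogeneous hr, polyCoaction_of_homogeneous (hx.pow n),
    AddMonoidAlgebra.single_mul_single, hs]

/-- The projection of `R_x` to its component of degree `u`. -/
noncomputable def awayProj (hx : IsWeightedHomogeneous (stdWeight d) x δ) (u : Fin d → ℤ) :
    Localization.Away x →+ Localization.Away x where
  toFun z := (awayCoaction hx z).coeff u
  map_zero' := by simp
  map_add' := by simp

theorem awayProj_apply (hx : IsWeightedHomogeneous (stdWeight d) x δ) (u : Fin d → ℤ)
    (z : Localization.Away x) : awayProj hx u z = (awayCoaction hx z).coeff u :=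
  rfl

theorem awayProj_of_mem (hx : IsWeightedHomogeneous (stdWeight d) x δ) {u : Fin d → ℤ}
    {z : Localization.Away x} (hz : z ∈ awayPart hx u) : awayProj hx u z = z := by
  simp [awayProj_apply, awayCoaction_of_mem hx hz]

/-- By additivity the numerator may be taken to be a single term; the fraction is then homogeneous,
and its projection is itself or zero. -/
theorem awayProj_mem (hx : IsWeightedHomogeneous (stdWeight d) x δ) (u : Fin d → ℤ)
    (z : Localization.Away x) : awayProj hx u z ∈ awayPart hx u := by
  induction z using Localization.induction_on with
  | _ q =>
  obtain ⟨r, _, n, rfl⟩ := q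
  induction r using MvPolynomial.induction_on' with
  | monomial w c =>
    have hz : Localization.mk (monomial w c) (⟨x ^ n, n, rfl⟩ : Submonoid.powers x) ∈
        awayPart hx (intDegree w - n • δ) :=
      ⟨n, monomial w c, by rw [sub_add_cancel]; exact monomial_homogeneous w c, rfl⟩
    by_cases h : intDegree w - n • δ = u
    · subst h
      exact (awayProj_of_mem hx hz).symm ▸ hz
    · rw [awayProj_apply, awayCoaction_of_mem hx hz, AddMonoidAlgebra.coeff_single,
        Finsupp.single_eq_of_ne (Ne.symm h)]
      exact zero_mem _
  | add p q hp hq =>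
    have h : Localization.mk (p + q) (⟨x ^ n, n, rfl⟩ : Submonoid.powers x) =
        Localization.mk p (⟨x ^ n, n, rfl⟩ : Submonoid.powers x) +
          Localization.mk q (⟨x ^ n, n, rfl⟩ : Submonoid.powers x) :=
      (Localization.add_mk_self p _ q).symm
    exact h ▸ (map_add (awayProj hx u) _ _).symm ▸ add_mem hp hq

/-- Both composites of coaction and restriction are algebra maps out of `R_x`, so they need only be
compared on the variables. -/
theorem awayProj_awayRes (hx : IsWeightedHomogeneous (stdWeight d) x δ)
    (hy : IsWeightedHomogeneous (stdWeight d) y ε) (h : x ∣ y) (u : Fin d → ℤ)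
    (z : Localization.Away x) :
    awayProj hy u (awayRes h z) = awayRes h (awayProj hx u z) := by
  have key : (awayCoaction hy).comp ((awayRes h).restrictScalars A) =
      (AddMonoidAlgebra.mapAlgHom _ ((awayRes h).restrictScalars A)).comp (awayCoaction hx) := by
    refine IsLocalization.algHom_ext (Submonoid.powers x) ?_
    refine MvPolynomial.algHom_ext fun k => ?_
    change awayCoaction hy (awayRes h (algebraMap _ _ (X k))) =
      AddMonoidAlgebra.mapAlgHom _ _ (awayCoaction hx (algebraMap _ _ (X k)))
    rw [AlgHom.commutes, awayCoaction_algebraMap, awayCoaction_algebraMap, polyCoaction,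
      polyCoaction, aeval_X, aeval_X, AddMonoidAlgebra.mapAlgHom_single,
      AlgHom.restrictScalars_apply, AlgHom.commutes]
  have := congrArg (fun f => (f z).coeff u) key
  simpa [awayProj_apply] using this

end Coaction

/-! ### Multiplication by a monomial on a localization -/

section Multiplication

variable {A : Type*} [CommRing A] {d : ℕ} {x : MvPolynomial (Fin d) A} {δ : Fin d → ℤ}

theorem monomial_smul_injective (x : MvPolynomial (Fin d) A) (v : Fin d →₀ ℕ) :
    Function.Injective fun z : Localization.Away x => monomial v (1 : A) • z := by
  refine (injective_iff_map_eq_zero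
    (DistribSMul.toAddMonoidHom (Localization.Away x) (monomial v (1 : A)))).mpr fun z hz => ?_
  induction z using Localization.induction_on with
  | _ q =>
  obtain ⟨r, s⟩ := q
  rw [DistribSMul.toAddMonoidHom_apply, Localization.smul_mk, Localization.mk_eq_mk',
    IsLocalization.mk'_eq_zero_iff] at hz
  obtain ⟨c, hc⟩ := hz
  rw [Localization.mk_eq_mk', IsLocalization.mk'_eq_zero_iff]
  refine ⟨c, isLeftRegular_monomial_one v ?_⟩
  simp only [smul_eq_mul, mul_zero] at hc ⊢
  rw [← hc]
  ring

theorem monomial_smul_mem_awayPart (hx : IsWeightedHomogeneous (stdWeight d) x δ)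
    (v : Fin d →₀ ℕ) {u : Fin d → ℤ} {z : Localization.Away x} (hz : z ∈ awayPart hx u) :
    monomial v (1 : A) • z ∈ awayPart hx (u + intDegree v) := by
  obtain ⟨n, r, hr, rfl⟩ := hz
  refine ⟨n, monomial v 1 * r, ?_, Localization.smul_mk _ _ _⟩
  have h := (monomial_homogeneous v (1 : A)).mul hr
  rwa [show intDegree v + (u + n • δ) = u + intDegree v + n • δ by abel] at h

/-- Expanding the fraction by a high power of `x` makes its numerator divisible by `X^v`. The
hypothesis `huv` says that no coordinate passes from negative to nonnegative. -/
theorem exists_monomial_smul_eq (hx : IsWeightedHomogeneous (stdWeight d) x δ)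
    (hδ : ∀ k, 0 ≤ δ k) (v : Fin d →₀ ℕ) {u : Fin d → ℤ}
    (huv : ∀ k, 0 ≤ u k ∨ u k + intDegree v k < 0) {z : Localization.Away x}
    (hz : z ∈ awayPart hx (u + intDegree v)) :
    ∃ y ∈ awayPart hx u, monomial v (1 : A) • y = z := by
  obtain ⟨n, r, hr, rfl⟩ := hz
  obtain ⟨m, p, hp, hpr⟩ : ∃ (m : ℕ) (p : MvPolynomial (Fin d) A),
      IsWeightedHomogeneous (stdWeight d) p (u + (n + m) • δ) ∧ monomial v 1 * p = x ^ m * r := by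
    obtain rfl | ⟨w, c, rfl, hw⟩ := hr.eq_zero_or_monomial
    · exact ⟨0, 0, isWeightedHomogeneous_zero A _ _, by simp⟩
    -- The exponent `∑ k, v k` bounds every `v k`, so one power of `x` serves all coordinates with
    -- `δ k ≥ 1`.
    obtain h | ⟨e, a, he, hed⟩ := ((hx.pow (∑ k, v k)).mul hr).eq_zero_or_monomial
    -- Coefficients may be zero divisors, so the expanded numerator can vanish; the fraction is then
    -- zero.
    · exact ⟨∑ k, v k, 0, isWeightedHomogeneous_zero A _ _, by rw [h, mul_zero]⟩
    have hve : v ≤ e := fun k => by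
      have h1 := congrFun hw k
      have h2 := congrFun hed k
      have h3 : v k ≤ ∑ k, v k := Finset.single_le_sum (fun _ _ => Nat.zero_le _) (Finset.mem_univ k)
      have h4 := huv k
      simp only [intDegree, Pi.add_apply, Pi.smul_apply, ← natCast_zsmul, smul_eq_mul] at h1 h2 h4
      zify at h3 ⊢
      push_cast at h2
      -- If `δ k = 0`, then `u k + v k` is the exponent `w k ≥ 0`, so `huv` forces `u k ≥ 0` and `e
      -- k = w k ≥ v k`.
      rcases (hδ k).eq_or_lt with h0 | h0
      · rw [← h0] at h1 h2
        simp only [mul_zero, zero_add] at h1 h2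
        omega
      · have h5 : (∑ k, (v k : ℤ)) * 1 ≤ (∑ k, (v k : ℤ)) * δ k :=
          mul_le_mul_of_nonneg_left h0 (Finset.sum_nonneg fun _ _ => by positivity)
        omega
    refine ⟨∑ k, v k, monomial (e - v) a, ?_, ?_⟩
    · have h := monomial_homogeneous (e - v) a
      convert h using 1
      have h1 : intDegree (e - v) = intDegree e - intDegree v := by
        ext k
        simp [intDegree, Nat.cast_sub (hve k)]
      rw [h1, hed, add_smul]
      abel
    · rw [monomial_mul, one_mul, add_tsub_cancel_of_le hve, he]
  refine ⟨_, ⟨n + m, p, hp, rfl⟩, ?_⟩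
  rw [Localization.smul_mk, smul_eq_mul, hpr, Localization.mk_eq_mk_iff, Localization.r_iff_exists]
  refine ⟨1, ?_⟩
  simp only [OneMemClass.coe_one]
  ring

end Multiplication

/-! ### Passage to the Čech complex and its cohomology -/

namespace CMonomialGenerators

variable {A : Type*} [CommRing A] {d : ℕ} {I : Ideal (MvPolynomial (Fin d) A)}
  (P : CMonomialGenerators I)

theorem sum_deg_nonneg (S : Finset (Fin P.t)) (k : Fin d) : 0 ≤ (∑ j ∈ S, P.deg j) k := by
  rw [Finset.sum_apply]
  exact Finset.sum_nonneg fun j _ => Int.natCast_nonneg _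

theorem mem_cochainPart {i : ℕ} {u : Fin d → ℤ} {z : CechCochain P.gen i} :
    z ∈ P.cochainPart i u ↔ ∀ S, z S ∈ awayPart (P.prod_gen_homogeneous S.1) u := by
  simp [cochainPart, Submodule.mem_pi]

/-- The projection of the Čech cochains to those of multidegree `u`. -/
noncomputable def cochainProj (i : ℕ) (u : Fin d → ℤ) (z : CechCochain P.gen i) :
    CechCochain P.gen i :=
  fun S => awayProj (P.prod_gen_homogeneous S.1) u (z S)

theorem cochainProj_mem (i : ℕ) (u : Fin d → ℤ) (z : CechCochain P.gen i) :
    P.cochainProj i u z ∈ P.cochainPart i u :=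
  P.mem_cochainPart.mpr fun _ => awayProj_mem _ _ _

theorem cochainProj_of_mem {i : ℕ} {u : Fin d → ℤ} {z : CechCochain P.gen i}
    (hz : z ∈ P.cochainPart i u) : P.cochainProj i u z = z :=
  funext fun S => awayProj_of_mem _ (P.mem_cochainPart.mp hz S)

theorem cochainProj_cechD (i : ℕ) (u : Fin d → ℤ) (z : CechCochain P.gen i) :
    P.cochainProj (i + 1) u (cechD P.gen i z) = cechD P.gen i (P.cochainProj i u z) := by
  funext S
  rw [cochainProj, cechD_apply, cechD_apply]
  rw [map_sum]
  refine Finset.sum_congr rfl fun j _ => ?_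
  -- The projection is only known to be additive, so the sign is treated by cases.
  rcases neg_one_pow_eq_or (MvPolynomial (Fin d) A) (S.1.filter (· < j.1)).card with h | h
  · rw [h, one_smul, one_smul]
    exact awayProj_awayRes (P.prod_gen_homogeneous _) _ _ u _
  · rw [h, neg_one_smul, neg_one_smul, map_neg]
    exact congrArg _ (awayProj_awayRes (P.prod_gen_homogeneous _) _ _ u _)

theorem monomial_smul_cochain_injective (i : ℕ) (v : Fin d →₀ ℕ) :
    Function.Injective fun z : CechCochain P.gen i => monomial v (1 : A) • z :=
  fun _ _ h => funext fun S => monomial_smul_injective _ v (congrFun h S)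

theorem monomial_smul_mem_cochainPart {i : ℕ} (v : Fin d →₀ ℕ) {u : Fin d → ℤ}
    {z : CechCochain P.gen i} (hz : z ∈ P.cochainPart i u) :
    monomial v (1 : A) • z ∈ P.cochainPart i (u + intDegree v) :=
  P.mem_cochainPart.mpr fun S => monomial_smul_mem_awayPart _ v (P.mem_cochainPart.mp hz S)

theorem exists_monomial_smul_cochain_eq {i : ℕ} (v : Fin d →₀ ℕ) {u : Fin d → ℤ}
    (huv : ∀ k, 0 ≤ u k ∨ u k + intDegree v k < 0) {z : CechCochain P.gen i}
    (hz : z ∈ P.cochainPart i (u + intDegree v)) :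
    ∃ y ∈ P.cochainPart i u, monomial v (1 : A) • y = z := by
  have hS (S : {S : Finset (Fin P.t) // S.card = i}) :
      ∃ y ∈ awayPart (P.prod_gen_homogeneous S.1) u, monomial v (1 : A) • y = z S :=
    exists_monomial_smul_eq _ (P.sum_deg_nonneg S.1) v huv (P.mem_cochainPart.mp hz S)
  choose y hy hyz using hS
  exact ⟨y, P.mem_cochainPart.mpr hy, funext hyz⟩

theorem mem_component {i : ℕ} {u : Fin d → ℤ} {h : P.LocalCohomology i} :
    h ∈ P.component i u ↔ ∃ z : cechCocycles P.gen i, z.1 ∈ P.cochainPart i u ∧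
      Submodule.Quotient.mk z = h :=
  Iff.rfl

/-- A coboundary divisible by a monomial is the multiple of a coboundary, provided that the
multiplication by the monomial stays in one block. -/
theorem mem_cechCoboundaries_of_monomial_smul {i : ℕ} (v : Fin d →₀ ℕ) {u : Fin d → ℤ}
    (huv : ∀ k, 0 ≤ u k ∨ u k + intDegree v k < 0) {z : CechCochain P.gen i}
    (hz : z ∈ P.cochainPart i u)
    (hvz : monomial v (1 : A) • z ∈ cechCoboundaries P.gen i) :
    z ∈ cechCoboundaries P.gen i := by
  cases i with
  | zero =>
    refine (Submodule.mem_bot _).mpr (P.monomial_smul_cochain_injective 0 v ?_)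
    simpa using (Submodule.mem_bot _).mp hvz
  | succ i =>
    obtain ⟨y, hy⟩ := hvz
    -- The cochain `y` need not be homogeneous; its part of degree `u + v` has the same coboundary
    -- and is divisible by `X^v`.
    obtain ⟨y', -, hy'⟩ := P.exists_monomial_smul_cochain_eq v huv
      (P.cochainProj_mem i (u + intDegree v) y)
    refine ⟨y', P.monomial_smul_cochain_injective (i + 1) v ?_⟩
    simp only
    rw [← map_smul, hy', ← cochainProj_cechD, hy,
      P.cochainProj_of_mem (P.monomial_smul_mem_cochainPart v hz)]

/-- Multiplication by a monomial of multidegree `v` is an isomorphism from the component of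
multidegree `u` onto that of multidegree `u + v`, if `u` and `u + v` lie in the same block. -/
theorem nonempty_component_equiv_add (i : ℕ) (v : Fin d →₀ ℕ) {u : Fin d → ℤ}
    (huv : ∀ k, 0 ≤ u k ∨ u k + intDegree v k < 0) :
    Nonempty (P.component i u ≃ₗ[A] P.component i (u + intDegree v)) := by
  let f : P.LocalCohomology i →ₗ[A] P.LocalCohomology i :=
    (LinearMap.lsmul (MvPolynomial (Fin d) A) (P.LocalCohomology i)
      (monomial v 1)).restrictScalars A
  have hf (z : cechCocycles P.gen i) : f (Submodule.Quotient.mk z) =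
      Submodule.Quotient.mk (monomial v (1 : A) • z) := rfl
  have hmaps : ∀ h ∈ P.component i u, f h ∈ P.component i (u + intDegree v) := by
    rintro _ ⟨z, hz, rfl⟩
    exact P.mem_component.mpr ⟨_, P.monomial_smul_mem_cochainPart v hz, rfl⟩
  refine ⟨LinearEquiv.ofBijective (f.restrict hmaps) ⟨?_, ?_⟩⟩
  · refine (injective_iff_map_eq_zero _).mpr ?_
    rintro ⟨_, hh⟩ h0
    obtain ⟨z, hz, rfl⟩ := P.mem_component.mp hh
    have h1 : f (Submodule.Quotient.mk z) = 0 := congrArg Subtype.val h0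
    rw [hf, Submodule.Quotient.mk_eq_zero] at h1
    refine Subtype.ext ((Submodule.Quotient.mk_eq_zero _).mpr ?_)
    exact P.mem_cechCoboundaries_of_monomial_smul v huv hz h1
  · rintro ⟨_, hh⟩
    obtain ⟨z, hz, rfl⟩ := P.mem_component.mp hh
    obtain ⟨y, hy, hyz⟩ := P.exists_monomial_smul_cochain_eq v huv hz
    -- The quotient of a cocycle by `X^v` is a cocycle, because `X^v` acts injectively on cochains
    -- of degree `i + 1`.
    have hy0 : cechD P.gen i y = 0 := by
      refine P.monomial_smul_cochain_injective (i + 1) v ?_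
      simp only
      rw [← map_smul, hyz, smul_zero]
      exact z.2
    refine ⟨⟨_, P.mem_component.mpr ⟨⟨y, hy0⟩, hy, rfl⟩⟩, Subtype.ext ?_⟩
    exact (hf _).trans (congrArg _ (Subtype.ext hyz))

theorem nonempty_component_equiv_of_le (i : ℕ) {U : Finset (Fin d)} {u w : Fin d → ℤ}
    (hu : u ∈ block U) (hw : w ∈ block U) (huw : u ≤ w) :
    Nonempty (P.component i u ≃ₗ[A] P.component i w) := by
  let v : Fin d →₀ ℕ := Finsupp.equivFunOnFinite.symm fun k => (w k - u k).toNat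
  have hv : u + intDegree v = w := by
    ext k
    have : u k ≤ w k := huw k
    simp only [intDegree, v, Pi.add_apply, Finsupp.coe_equivFunOnFinite_symm]
    omega
  have h := P.nonempty_component_equiv_add i v (u := u) fun k => by
    rw [← Pi.add_apply, hv]
    by_cases hk : k ∈ U
    · exact Or.inl ((hu k).1 hk)
    · exact Or.inr (Int.lt_of_le_sub_one ((hw k).2 hk))
  rwa [hv] at h

/-- The components of the local cohomology in multidegrees of the same block are isomorphic. -/
theorem nonempty_component_equiv (i : ℕ) {U : Finset (Fin d)} {u w : Fin d → ℤ}
    (hu : u ∈ block U) (hw : w ∈ block U) :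
    Nonempty (P.component i u ≃ₗ[A] P.component i w) := by
  -- Only multiplication by monomials is available, so both degrees are raised to a common upper
  -- bound in the block.
  have huw : u ⊔ w ∈ block U := fun k =>
    ⟨fun hk => le_sup_of_le_left ((hu k).1 hk), fun hk => sup_le ((hu k).2 hk) ((hw k).2 hk)⟩
  obtain ⟨e⟩ := P.nonempty_component_equiv_of_le i hu huw le_sup_left
  obtain ⟨e'⟩ := P.nonempty_component_equiv_of_le i hw huw le_sup_right
  exact ⟨e.trans e'.symm⟩

end CMonomialGenerators

/-! ### The theorem on blocks -/

theorem blockVector_mem_block {d : ℕ} (U : Finset (Fin d)) : blockVector U ∈ block U :=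
  fun k => ⟨fun hk => by simp [blockVector, hk], fun hk => by simp [blockVector, hk]⟩

theorem theorem3p1 {A : Type*} [CommRing A] [IsNoetherianRing A]
    (hA : ∃ k : Subring A, IsField k ∧ CharZero k)
    {d : ℕ} (I : Ideal (MvPolynomial (Fin d) A)) (P : CMonomialGenerators I) (i : ℕ)
    (U : Finset (Fin d)) :
    ((∀ u ∈ block U, P.component i u ≠ ⊥) ↔ (∃ w ∈ block U, P.component i w ≠ ⊥)) ∧
      ∀ u ∈ block U, Nonempty (P.component i u ≃ₗ[A] P.component i (blockVector U)) := by
  refine ⟨⟨fun h => ⟨_, blockVector_mem_block U, h _ (blockVector_mem_block U)⟩, ?_⟩,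
    fun u hu => P.nonempty_component_equiv i hu (blockVector_mem_block U)⟩
  rintro ⟨w, hw, hne⟩ u hu h0
  obtain ⟨e⟩ := P.nonempty_component_equiv i hw hu
  have : Subsingleton (P.component i u) := Submodule.subsingleton_iff_eq_bot.mpr h0
  exact hne (Submodule.subsingleton_iff_eq_bot.mp e.toEquiv.subsingleton)
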